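/- All graphs are finite and simple. For a graph $G$ with at least one edge, the cyclic matching sequenceability $\mathrm{cms}(G)$ is the largest integer $s\le |E(G)|$ for which there is a cyclic ordering of the edges of $G$ such that every set of $s$ cyclically consecutive edges forms a matching. A graph is class 1 if its chromatic index equals its maximum degree. Let $\mathrm{cms}(n,2)$ be the minimum of $\mathrm{cms}(G)$ over all $2$-regular graphs $G$ on $n$ vertices, and let $\mathrm{cms}_1(n,2)$ be the minimum of $\mathrm{cms}(G)$ over all $2$-regular class 1 graphs $G$ on $n$ vertices. Then $\mathrm{cms}(n,2)=\lfloor n/3\rfloor$ for each integer $n\ge 6$, and $\mathrm{cms}_1(n,2)=\frac{n-2}{2}$ for each even integer $n\ge 4$. -/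

import Mathlib

namespace SimpleGraph

/-- A set of edges forms a matching if no two distinct edges in it share a vertex. -/
def IsEdgeMatching {V : Type*} (M : Set (Sym2 V)) : Prop :=
  ∀ e ∈ M, ∀ f ∈ M, e ≠ f → ∀ v : V, ¬ (v ∈ e ∧ v ∈ f)

/-- An ordering of a graph with `m` edges: a bijection from its edges to the integers modulo `m`.
The element assigned to an edge is its label. -/
abbrev EdgeOrdering {V : Type*} (G : SimpleGraph V) : Type _ :=
  G.edgeSet ≃ ZMod (Nat.card G.edgeSet)

/-- The set of `s` cyclically consecutive edges with labels `i, i + 1, …, i + (s - 1)`. -/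
def EdgeOrdering.window {V : Type*} {G : SimpleGraph V} (l : G.EdgeOrdering)
    (i : ZMod (Nat.card G.edgeSet)) (s : ℕ) : Set (Sym2 V) :=
  {e | ∃ j : ℕ, j < s ∧ e = (l.symm (i + (j : ZMod (Nat.card G.edgeSet))) : Sym2 V)}

/-- `s` is at most the number of edges, and some cyclic ordering of the edges has the property that
every set of `s` cyclically consecutive edges forms a matching. -/
def IsCyclicallyMatchingSequenceable {V : Type*} (G : SimpleGraph V) (s : ℕ) : Prop :=
  s ≤ Nat.card G.edgeSet ∧
    ∃ l : G.EdgeOrdering, ∀ i : ZMod (Nat.card G.edgeSet), IsEdgeMatching (l.window i s)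

/-- The cyclic matching sequenceability of a (finite) graph: the largest such `s`. -/
noncomputable def cms {V : Type*} (G : SimpleGraph V) : ℕ :=
  sSup {s | G.IsCyclicallyMatchingSequenceable s}

/-- For a finite graph with an edge, the supremum defining `cms` is an attained maximum. -/
theorem isGreatest_cms {V : Type*} [Finite V] (G : SimpleGraph V) (hG : G.edgeSet.Nonempty) :
    IsGreatest {s | G.IsCyclicallyMatchingSequenceable s} G.cms := by
  have hb : BddAbove {s | G.IsCyclicallyMatchingSequenceable s} := ⟨_, fun s hs => hs.1⟩
  refine ⟨Nat.sSup_mem ⟨0, Nat.zero_le _, ?_⟩ hb, fun s hs => le_csSup hb hs⟩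
  have : Nonempty G.edgeSet := hG.to_subtype
  have : NeZero (Nat.card G.edgeSet) := ⟨Nat.card_pos.ne'⟩
  refine ⟨(Finite.equivFin G.edgeSet).trans (ZMod.finEquiv _).toEquiv, fun i e he => ?_⟩
  obtain ⟨j, hj, -⟩ := he
  exact absurd hj (Nat.not_lt_zero j)

/-- The chromatic index: the least number of colours in a proper edge colouring, that is, in a
proper vertex colouring of the line graph. -/
noncomputable def chromaticIndex {V : Type*} (G : SimpleGraph V) : ℕ∞ :=
  G.lineGraph.chromaticNumber

open scoped Classical in
/-- A finite graph is class 1 if its chromatic index equals its maximum degree. -/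
def IsClassOne {V : Type*} [Fintype V] (G : SimpleGraph V) : Prop :=
  G.chromaticIndex = (G.maxDegree : ℕ∞)

open scoped Classical in
/-- The values of `cms` on the `k`-regular graphs on `n` vertices. -/
def cmsValues (n k : ℕ) : Set ℕ :=
  {s | ∃ G : SimpleGraph (Fin n), G.IsRegularOfDegree k ∧ G.cms = s}

open scoped Classical in
/-- The values of `cms` on the `k`-regular class 1 graphs on `n` vertices. -/
def cmsValuesClassOne (n k : ℕ) : Set ℕ :=
  {s | ∃ G : SimpleGraph (Fin n), G.IsRegularOfDegree k ∧ G.IsClassOne ∧ G.cms = s}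

end SimpleGraph

/-! An ordering works for `s` exactly when edges sharing a vertex have labels at cyclic distance at
least `s`. A 2-regular graph is a disjoint union of cycles; orienting them gives a permutation `σ`,
and `v ↦ s(v, σ v)` indexes the edges so that edges meet only when their indices are consecutive
under `σ`. Permutations with equal cycle type are conjugate, so for the lower bounds it suffices to
find, for each admissible cycle type, a permutation of `0, …, n - 1` that moves every number far
(`IsTraversal.isCyclicallyMatchingSequenceable`).

For `n / 3`, the numbers are written in three rows of nearly equal length, where moving to an
adjacent row without losing too many columns is a far move. Cycles of length at least 6 are
shortened by 3, and cycles of length 3, 4, 5 are packed into explicit rectangular blocks until a few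
small cases remain (`exists_threeRowRealizable`). In class 1 all cycles are even, and each one
zigzags through its own block of columns of a two-row array, which gives `(n - 2) / 2`.

Conversely, the labels of a triangle cut the circle into three arcs of length at least `s`, and a
path of three edges forces `2 * s < n`. The extremal graphs are a triangle plus a cycle, and a
single even cycle. -/

namespace SimpleGraph

/-! ### Orderings as labels at large cyclic distance -/

/-- Two labels `a, b < N` at cyclic distance at least `s` modulo `N`. -/
def CyclicallyFar (N s a b : ℕ) : Prop :=
  (a + s ≤ b ∧ b + s ≤ a + N) ∨ (b + s ≤ a ∧ a + s ≤ b + N)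

theorem CyclicallyFar.symm {N s a b : ℕ} (h : CyclicallyFar N s a b) : CyclicallyFar N s b a :=
  Or.symm h

/-- An injective labelling of the edges by `0, …, m - 1` in which edges sharing a vertex are at
cyclic distance at least `s` witnesses that every `s` cyclically consecutive edges form a
matching. -/
theorem isCyclicallyMatchingSequenceable_of_far {V : Type*} [Finite V] {G : SimpleGraph V} {s : ℕ}
    [Nonempty G.edgeSet]
    (hs : s ≤ Nat.card G.edgeSet) (pos : G.edgeSet → ℕ) (hinj : Function.Injective pos)
    (hlt : ∀ e, pos e < Nat.card G.edgeSet)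
    (hfar : ∀ e f : G.edgeSet, e ≠ f → ∀ v : V, v ∈ e.1 → v ∈ f.1 →
      CyclicallyFar (Nat.card G.edgeSet) s (pos e) (pos f)) :
    G.IsCyclicallyMatchingSequenceable s := by
  refine ⟨hs, ?_⟩
  have hN0 : NeZero (Nat.card G.edgeSet) := ⟨Nat.card_pos.ne'⟩
  have hcinj : Function.Injective (fun e => (pos e : ZMod (Nat.card G.edgeSet))) := by
    intro e f h
    apply hinj
    have := (ZMod.natCast_eq_natCast_iff' _ _ _).1 h
    rwa [Nat.mod_eq_of_lt (hlt e), Nat.mod_eq_of_lt (hlt f)] at this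
  have hbij : Function.Bijective (fun e => (pos e : ZMod (Nat.card G.edgeSet))) :=
    (Nat.bijective_iff_injective_and_card _).2 ⟨hcinj, by rw [Nat.card_zmod]⟩
  let l : G.edgeSet ≃ ZMod (Nat.card G.edgeSet) := Equiv.ofBijective _ hbij
  have key : ∀ i : ZMod (Nat.card G.edgeSet), ∀ j k : ℕ, j < s → k < s → ∀ v : V,
      l.symm (i + j) ≠ l.symm (i + k) →
      v ∈ (l.symm (i + j)).1 → v ∈ (l.symm (i + k)).1 → False := by
    intro i j k hj hk v hne h1 h2
    have hf := hfar _ _ hne v h1 h2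
    have e1 : ((pos (l.symm (i + j)) : ℕ) : ZMod (Nat.card G.edgeSet)) = i + j :=
      l.apply_symm_apply (i + j)
    have e2 : ((pos (l.symm (i + k)) : ℕ) : ZMod (Nat.card G.edgeSet)) = i + k :=
      l.apply_symm_apply (i + k)
    have h1' := hlt (l.symm (i + j))
    have h2' := hlt (l.symm (i + k))
    generalize pos (l.symm (i + j)) = p at *
    generalize pos (l.symm (i + k)) = q at *
    have h3 : (((p : ℤ) - q - (j - k) : ℤ) : ZMod (Nat.card G.edgeSet)) = 0 := by
      push_cast
      rw [e1, e2]; ring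
    obtain ⟨c, hc⟩ := (ZMod.intCast_zmod_eq_zero_iff_dvd _ _).1 h3
    -- Here `|p - q| ≤ N - s` and `|j - k| < s`, so the multiple `N * c` of `N` has absolute value
    -- below `N`.
    have hc0 : c = 0 := by
      by_contra h0
      rcases lt_or_gt_of_ne h0 with h | h
      · have : (Nat.card G.edgeSet : ℤ) * c ≤ -Nat.card G.edgeSet := by nlinarith
        rcases hf with hf | hf <;> omega
      · have : (Nat.card G.edgeSet : ℤ) ≤ Nat.card G.edgeSet * c := by nlinarith
        rcases hf with hf | hf <;> omega
    subst hc0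
    rcases hf with hf | hf <;> omega
  refine ⟨l, fun i => ?_⟩
  rintro e ⟨j, hj, rfl⟩ f ⟨k, hk, rfl⟩ hne v ⟨h1, h2⟩
  exact key i j k hj hk v (fun h => hne (congrArg _ h)) h1 h2

/-- The converse of `isCyclicallyMatchingSequenceable_of_far`. -/
theorem IsCyclicallyMatchingSequenceable.exists_far {V : Type*} [Finite V] {G : SimpleGraph V}
    {s : ℕ} [Nonempty G.edgeSet] (h : G.IsCyclicallyMatchingSequenceable s) :
    ∃ pos : G.edgeSet → ℕ, Function.Injective pos ∧ (∀ e, pos e < Nat.card G.edgeSet) ∧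
      ∀ e f : G.edgeSet, e ≠ f → ∀ v : V, v ∈ e.1 → v ∈ f.1 →
        CyclicallyFar (Nat.card G.edgeSet) s (pos e) (pos f) := by
  obtain ⟨hs, l, hl⟩ := h
  have hN0 : NeZero (Nat.card G.edgeSet) := ⟨Nat.card_pos.ne'⟩
  have key : ∀ e f : G.edgeSet, e ≠ f → ∀ v : V, v ∈ e.1 → v ∈ f.1 → ∀ j : ℕ, j < s →
      l f ≠ l e + j := by
    intro e f hne v he hf j hj hlf
    refine hl (l e) e.1 ⟨0, by omega, ?_⟩ f.1 ⟨j, hj, ?_⟩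
      (fun h => hne (Subtype.ext h)) v ⟨he, hf⟩
    · rw [Nat.cast_zero, add_zero]
      exact congrArg _ (l.symm_apply_apply e).symm
    · rw [← hlf]
      exact congrArg _ (l.symm_apply_apply f).symm
  refine ⟨fun e => (l e).val, (ZMod.val_injective _).comp l.injective, fun e => ZMod.val_lt _, ?_⟩
  have main : ∀ e f : G.edgeSet, e ≠ f → ∀ v : V, v ∈ e.1 → v ∈ f.1 → (l e).val < (l f).val →
      CyclicallyFar (Nat.card G.edgeSet) s (l e).val (l f).val := by
    intro e f hne v he hf hlt
    have hfN := ZMod.val_lt (l f)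
    refine Or.inl ⟨?_, ?_⟩
    · by_contra hlt'
      refine key e f hne v he hf ((l f).val - (l e).val) (by omega) ?_
      rw [Nat.cast_sub hlt.le, ZMod.natCast_zmod_val, ZMod.natCast_zmod_val]
      ring
    · by_contra hlt'
      refine key f e hne.symm v hf he ((l e).val + Nat.card G.edgeSet - (l f).val) (by omega) ?_
      rw [Nat.cast_sub (by omega), Nat.cast_add, ZMod.natCast_zmod_val, ZMod.natCast_zmod_val,
        ZMod.natCast_self]
      ring
  intro e f hne v he hf
  rcases lt_trichotomy (l e).val (l f).val with h | h | h
  · exact main e f hne v he hf h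
  · exact absurd (l.injective (ZMod.val_injective _ h)) hne
  · exact (main f e hne.symm v hf he h).symm

/-! ### Upper bounds from small subgraphs -/

/-- In a graph containing a triangle, at most a third of the edges can be consecutive. -/
theorem IsCyclicallyMatchingSequenceable.le_of_triangle {V : Type*} [Finite V] {G : SimpleGraph V}
    {s : ℕ} {a b c : V} (hab : G.Adj a b) (hbc : G.Adj b c) (hca : G.Adj c a)
    (h : G.IsCyclicallyMatchingSequenceable s) : s ≤ Nat.card G.edgeSet / 3 := by
  let e : G.edgeSet := ⟨s(a, b), hab⟩
  let f : G.edgeSet := ⟨s(b, c), hbc⟩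
  let g : G.edgeSet := ⟨s(c, a), hca⟩
  have : Nonempty G.edgeSet := ⟨e⟩
  obtain ⟨pos, hinj, hlt, hfar⟩ := h.exists_far
  have hef : e ≠ f := by
    intro h; have := congrArg Subtype.val h; simp [e, f, hab.ne, hca.ne'] at this
  have hfg : f ≠ g := by
    intro h; have := congrArg Subtype.val h; simp [f, g, hbc.ne, hab.ne'] at this
  have hge : g ≠ e := by
    intro h; have := congrArg Subtype.val h; simp [g, e, hca.ne, hbc.ne'] at this
  have h1 := hfar e f hef b (by simp [e]) (by simp [f])
  have h2 := hfar f g hfg c (by simp [f]) (by simp [g])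
  have h3 := hfar g e hge a (by simp [g]) (by simp [e])
  have h4 := h.1
  have := hlt e
  have := hlt f
  have := hlt g
  unfold CyclicallyFar at h1 h2 h3
  omega

/-- In a graph containing a path with three edges, fewer than half of the edges can be
consecutive. -/
theorem IsCyclicallyMatchingSequenceable.lt_of_path {V : Type*} [Finite V] {G : SimpleGraph V}
    {s : ℕ} {a b c d : V} (hab : G.Adj a b) (hbc : G.Adj b c) (hcd : G.Adj c d) (hac : a ≠ c)
    (hbd : b ≠ d) (h : G.IsCyclicallyMatchingSequenceable s) : 2 * s < Nat.card G.edgeSet := by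
  let e : G.edgeSet := ⟨s(a, b), hab⟩
  let f : G.edgeSet := ⟨s(b, c), hbc⟩
  let g : G.edgeSet := ⟨s(c, d), hcd⟩
  have : Nonempty G.edgeSet := ⟨e⟩
  obtain ⟨pos, hinj, hlt, hfar⟩ := h.exists_far
  have hef : e ≠ f := by
    intro h; have := congrArg Subtype.val h; simp [e, f, hab.ne, hac] at this
  have hfg : f ≠ g := by
    intro h; have := congrArg Subtype.val h; simp [f, g, hbc.ne, hbd] at this
  have hge : pos g ≠ pos e := by
    intro h; have := congrArg Subtype.val (hinj h); simp [g, e, hac.symm, hbc.ne'] at this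
  have h1 := hfar e f hef b (by simp [e]) (by simp [f])
  have h2 := hfar f g hfg c (by simp [f]) (by simp [g])
  have := hlt e
  have := hlt f
  have := hlt g
  -- If `2 * s ≥ N`, at most one label is at distance at least `s` from that of `f`, so `e` and `g`
  -- would share it.
  unfold CyclicallyFar at h1 h2
  omega

end SimpleGraph

/-! ### Permutations from cyclic lists -/

/-- Cyclically consecutive entries of the list are related by `R`. -/
def List.IsCyclicChain {α : Type*} (R : α → α → Prop) (l : List α) : Prop :=
  l.IsChain R ∧ ∀ a ∈ l.getLast?, ∀ b ∈ l.head?, R a b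

theorem List.IsCyclicChain.rel_formPerm {α : Type*} [DecidableEq α] {R : α → α → Prop} {l : List α}
    (h : l.IsCyclicChain R) (hl : l.Nodup) {a : α} (ha : a ∈ l) : R a (l.formPerm a) := by
  obtain ⟨i, hi, rfl⟩ := List.getElem_of_mem ha
  rw [List.formPerm_apply_getElem _ hl]
  rcases Nat.lt_or_ge (i + 1) l.length with h1 | h1
  · have := List.isChain_iff_getElem.1 h.1 i h1
    simpa [Nat.mod_eq_of_lt h1] using this
  · have h2 : i + 1 = l.length := by omega
    have hne : l ≠ [] := List.ne_nil_of_mem ha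
    have := h.2 (l.getLast hne) (List.getLast?_eq_getLast_of_ne_nil hne) (l.head hne)
      (List.head?_eq_some_head hne)
    have h3 : i = l.length - 1 := by omega
    simpa [h2, List.getLast_eq_getElem, List.head_eq_getElem, h3, Nat.sub_add_cancel
      (show 1 ≤ l.length by omega)] using this

/-- Excluding cycles of length two makes the successor and the predecessor of a vertex distinct,
hence its two neighbours. -/
theorem List.formPerm_formPerm_ne {α : Type*} [DecidableEq α] {l : List α} (hl : l.Nodup)
    (h3 : 3 ≤ l.length) {a : α} (ha : a ∈ l) : l.formPerm (l.formPerm a) ≠ a := by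
  obtain ⟨i, hi, rfl⟩ := List.getElem_of_mem ha
  rw [List.formPerm_apply_getElem _ hl, List.formPerm_apply_getElem _ hl, Ne, hl.getElem_inj_iff]
  rcases Nat.lt_or_ge (i + 1) l.length with h1 | h1
  · rw [Nat.mod_eq_of_lt h1]
    rcases Nat.lt_or_ge (i + 1 + 1) l.length with h2 | h2
    · rw [Nat.mod_eq_of_lt h2]; omega
    · rw [show i + 1 + 1 = l.length by omega, Nat.mod_self]; omega
  · rw [show i + 1 = l.length by omega, Nat.mod_self, Nat.mod_eq_of_lt (by omega)]; omega

/-- A partition of a finite type into cyclic lists is the cycle decomposition of a permutation. -/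
theorem Equiv.Perm.exists_of_cyclicChains {α : Type*} [Fintype α] [DecidableEq α]
    {R : α → α → Prop} {L : List (List α)} (hnd : L.flatten.Nodup) (hcov : ∀ a, a ∈ L.flatten)
    (hlen : ∀ l ∈ L, 3 ≤ l.length) (hR : ∀ l ∈ L, l.IsCyclicChain R) :
    ∃ σ : Equiv.Perm α, (∀ a, R a (σ a)) ∧ (∀ a, σ (σ a) ≠ a) ∧
      σ.cycleType = (L.map List.length : Multiset ℕ) := by
  obtain ⟨hnd1, hnd2⟩ := List.nodup_flatten.1 hnd
  have hsupp : ∀ l ∈ L, l.formPerm.support = l.toFinset := fun l hl =>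
    List.support_formPerm_of_nodup l (hnd1 l hl) (by
      rintro x rfl; simpa using hlen _ hl)
  have hdis : (L.map List.formPerm).Pairwise Equiv.Perm.Disjoint := by
    rw [List.pairwise_map]
    refine List.Pairwise.imp_of_mem ?_ hnd2
    intro l l' hl hl' h
    rw [Equiv.Perm.disjoint_iff_disjoint_support, hsupp l hl, hsupp l' hl', Finset.disjoint_left]
    intro a h1 h2
    exact h (List.mem_toFinset.1 h1) (List.mem_toFinset.1 h2)
  have happ : ∀ l ∈ L, ∀ a ∈ l, (L.map List.formPerm).prod a = l.formPerm a := by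
    intro l hl a ha
    refine (Equiv.Perm.eq_on_support_mem_disjoint (List.mem_map_of_mem hl) hdis a ?_).symm
    rw [hsupp l hl]
    exact List.mem_toFinset.2 ha
  refine ⟨(L.map List.formPerm).prod, ?_, ?_, ?_⟩
  · intro a
    obtain ⟨l, hl, ha⟩ := List.mem_flatten.1 (hcov a)
    rw [happ l hl a ha]
    exact (hR l hl).rel_formPerm (hnd1 l hl) ha
  · intro a
    obtain ⟨l, hl, ha⟩ := List.mem_flatten.1 (hcov a)
    rw [happ l hl a ha, happ l hl _ (List.formPerm_apply_mem_of_mem ha)]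
    exact List.formPerm_formPerm_ne (hnd1 l hl) (hlen l hl) ha
  · rw [Equiv.Perm.cycleType_eq _ rfl ?_ hdis, List.map_map]
    · congr 1
      refine List.map_congr_left fun l hl => ?_
      simp [hsupp l hl, List.toFinset_card_of_nodup (hnd1 l hl)]
    · intro τ hτ
      obtain ⟨l, hl, rfl⟩ := List.mem_map.1 hτ
      exact List.isCycle_formPerm (hnd1 l hl) (by have := hlen l hl; omega)

theorem Equiv.Perm.exists_pow_apply_eq_of_mem_cycleType {α : Type*} [Fintype α] [DecidableEq α]
    {σ : Equiv.Perm α} {n : ℕ} (h : n ∈ σ.cycleType) : ∃ a, (σ ^ n) a = a := by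
  obtain ⟨c, τ, rfl, hd, hc, rfl⟩ := Equiv.Perm.mem_cycleType_iff.1 h
  obtain ⟨a, ha, -⟩ := id hc
  refine ⟨a, ?_⟩
  rw [hd.commute.mul_pow, Equiv.Perm.mul_apply, Equiv.Perm.pow_apply_eq_self_of_apply_eq_self
    ((hd a).resolve_left ha), ← hc.orderOf, pow_orderOf_eq_one, Equiv.Perm.one_apply]

/-! ### Traversals of 2-regular graphs -/

namespace SimpleGraph

/-- The vertices of a graph in which every vertex has two neighbours can be listed cycle by
cycle. -/
theorem exists_cyclicChains_of_ncard_neighborSet {V : Type*} [Finite V] {G : SimpleGraph V}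
    (hG : ∀ v, (G.neighborSet v).ncard = 2) :
    ∃ L : List (List V), L.flatten.Nodup ∧ (∀ v, v ∈ L.flatten) ∧ (∀ l ∈ L, 3 ≤ l.length) ∧
      ∀ l ∈ L, l.IsCyclicChain G.Adj := by
  classical
  have := Fintype.ofFinite G.ConnectedComponent
  have hcyc : G.IsCycles := fun v _ => hG v
  have hc : ∀ c : G.ConnectedComponent, ∃ l : List V, l.Nodup ∧ (∀ v, v ∈ l ↔ v ∈ c.supp) ∧
      3 ≤ l.length ∧ l.IsCyclicChain G.Adj := by
    intro c
    obtain ⟨v, hv⟩ := c.nonempty_supp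
    obtain ⟨p, hp, hs⟩ := hcyc.exists_cycle_toSubgraph_verts_eq_connectedComponentSupp hv
      (Set.nonempty_of_ncard_ne_zero (by rw [hG]; norm_num))
    have h3 := hp.three_le_length
    have hnd := hp.support_nodup
    -- The closed walk visits its base vertex at both ends; dropping the first visit lists every
    -- vertex once, and the dropped step closes the cyclic chain.
    cases p with
    | nil => simp at h3
    | @cons _ w _ hvw q =>
      simp only [Walk.support_cons, List.tail_cons] at hnd
      refine ⟨q.support, hnd, ?_, ?_, q.isChain_adj_support, ?_⟩
      · intro x
        rw [← hs, Walk.mem_verts_toSubgraph, Walk.support_cons, List.mem_cons]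
        refine ⟨Or.inr, ?_⟩
        rintro (rfl | h)
        · exact q.end_mem_support
        · exact h
      · simpa using h3
      · intro a ha b hb
        rw [List.getLast?_eq_getLast_of_ne_nil q.support_ne_nil, Walk.getLast_support] at ha
        rw [List.head?_eq_some_head q.support_ne_nil, Walk.head_support] at hb
        simp only [Option.mem_def, Option.some.injEq] at ha hb
        exact ha ▸ hb ▸ hvw
  choose f hf1 hf2 hf3 hf4 using hc
  refine ⟨Finset.univ.toList.map f, ?_, ?_, ?_, ?_⟩
  · rw [List.nodup_flatten]
    refine ⟨by simpa using hf1, ?_⟩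
    rw [List.pairwise_map]
    refine (Finset.nodup_toList _).imp ?_
    intro c d hcd x h1 h2
    exact hcd (((hf2 c x).1 h1).symm.trans ((hf2 d x).1 h2))
  · intro v
    simp only [List.mem_flatten, List.mem_map, Finset.mem_toList, Finset.mem_univ, true_and,
      exists_exists_eq_and]
    exact ⟨G.connectedComponentMk v, (hf2 _ _).2 rfl⟩
  · simpa using hf3
  · simpa using hf4

/-- `σ` traverses every edge of `G` exactly once. -/
structure IsTraversal {V : Type*} (G : SimpleGraph V) (σ : Equiv.Perm V) : Prop where
  adj_iff : ∀ u v, G.Adj u v ↔ σ u = v ∨ σ v = u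
  ne : ∀ v, σ (σ v) ≠ v

namespace IsTraversal

variable {V : Type*} {G : SimpleGraph V} {σ : Equiv.Perm V}

theorem adj (h : G.IsTraversal σ) (v : V) : G.Adj v (σ v) := (h.adj_iff _ _).2 (Or.inl rfl)

theorem neighborSet_eq (h : G.IsTraversal σ) (v : V) : G.neighborSet v = {σ v, σ.symm v} := by
  ext w
  simp only [mem_neighborSet, h.adj_iff, Set.mem_insert_iff, Set.mem_singleton_iff,
    Equiv.eq_symm_apply, eq_comm]

theorem ncard_neighborSet (h : G.IsTraversal σ) (v : V) : (G.neighborSet v).ncard = 2 := by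
  rw [h.neighborSet_eq, Set.ncard_pair]
  intro h'
  exact h.ne v (by rw [h', Equiv.apply_symm_apply])

/-- The edges are indexed by the vertices from which they are traversed. -/
noncomputable def edgeEquiv (h : G.IsTraversal σ) : V ≃ G.edgeSet :=
  Equiv.ofBijective (fun v => ⟨s(v, σ v), h.adj v⟩) (by
    constructor
    · intro v w hvw
      have := congrArg Subtype.val hvw
      simp only [Sym2.eq_iff] at this
      rcases this with ⟨h1, -⟩ | ⟨h1, h2⟩
      · exact h1
      · exact absurd (by rw [← h1, h2]) (h.ne w)
    · rintro ⟨e, he⟩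
      induction e with
      | _ u v =>
        rcases (h.adj_iff u v).1 he with rfl | rfl
        · exact ⟨u, rfl⟩
        · exact ⟨v, Subtype.ext Sym2.eq_swap⟩)

theorem coe_edgeEquiv (h : G.IsTraversal σ) (v : V) : (h.edgeEquiv v : Sym2 V) = s(v, σ v) := rfl

theorem card_edgeSet (h : G.IsTraversal σ) : Nat.card G.edgeSet = Nat.card V :=
  (Nat.card_congr h.edgeEquiv).symm

/-- The only edges at `w` are those indexed by `w` and by its predecessor under `σ`. -/
theorem eq_of_mem_edgeEquiv (h : G.IsTraversal σ) {u v w : V} (huv : u ≠ v)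
    (hu : w ∈ (h.edgeEquiv u : Sym2 V)) (hv : w ∈ (h.edgeEquiv v : Sym2 V)) :
    v = σ u ∨ u = σ v := by
  rw [coe_edgeEquiv, Sym2.mem_iff] at hu hv
  rcases hu with rfl | rfl <;> rcases hv with hv | hv
  · exact absurd hv huv
  · exact Or.inr hv
  · exact Or.inl hv.symm
  · exact absurd (σ.injective hv) huv

end IsTraversal

/-- A graph whose vertices are listed cycle by cycle is traversed by the corresponding
permutation. -/
theorem exists_isTraversal_of_cyclicChains {V : Type*} [Fintype V] [DecidableEq V]
    {G : SimpleGraph V} (hG : ∀ v, (G.neighborSet v).ncard = 2) {L : List (List V)}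
    (hnd : L.flatten.Nodup) (hcov : ∀ v, v ∈ L.flatten) (hlen : ∀ l ∈ L, 3 ≤ l.length)
    (hR : ∀ l ∈ L, l.IsCyclicChain G.Adj) :
    ∃ σ, G.IsTraversal σ ∧ σ.cycleType = (L.map List.length : Multiset ℕ) := by
  obtain ⟨σ, hadj, hne, hct⟩ := Equiv.Perm.exists_of_cyclicChains hnd hcov hlen hR
  refine ⟨σ, ⟨fun u v => ⟨fun huv => ?_, ?_⟩, hne⟩, hct⟩
  · have hsub : ({σ u, σ.symm u} : Set V) ⊆ G.neighborSet u := by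
      rintro w (rfl | rfl)
      · exact hadj u
      · simpa using (hadj (σ.symm u)).symm
    have heq := Set.eq_of_subset_of_ncard_le hsub (by
      rw [hG, Set.ncard_pair]
      intro h'
      exact hne u (by rw [h', Equiv.apply_symm_apply])) (Set.toFinite _)
    have : v ∈ ({σ u, σ.symm u} : Set V) := heq ▸ huv
    rcases this with rfl | rfl
    · exact Or.inl rfl
    · exact Or.inr (σ.apply_symm_apply u)
  · rintro (rfl | rfl)
    · exact hadj u
    · exact (hadj v).symm

/-- If the vertices of a traversed graph can be rearranged so that successive vertices are far
apart, the graph is cyclically matching sequenceable. -/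
theorem IsTraversal.isCyclicallyMatchingSequenceable {n s : ℕ} (hn : n ≠ 0) (hs : s ≤ n)
    {G : SimpleGraph (Fin n)} {σ τ : Equiv.Perm (Fin n)} (h : G.IsTraversal σ)
    (hct : σ.cycleType = τ.cycleType) (hτ : ∀ a : Fin n, CyclicallyFar n s (a : ℕ) (τ a : ℕ)) :
    G.IsCyclicallyMatchingSequenceable s := by
  have hcard : Nat.card G.edgeSet = n := by rw [h.card_edgeSet, Nat.card_fin]
  have : Nonempty G.edgeSet := by
    have : NeZero n := ⟨hn⟩
    exact ⟨h.edgeEquiv 0⟩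
  -- The conjugator carries `σ` to `τ`; the edge leaving `v` is labelled `g v`, so the next edge is
  -- labelled `τ (g v)`.
  obtain ⟨g, hg⟩ := isConj_iff.1 (Equiv.Perm.isConj_of_cycleType_eq hct)
  have hgσ : ∀ v, τ (g v) = g (σ v) := by
    intro v; rw [← hg]; simp
  refine isCyclicallyMatchingSequenceable_of_far (by rwa [hcard])
    (fun e => (g (h.edgeEquiv.symm e) : ℕ))
    (fun e f hef => h.edgeEquiv.symm.injective (g.injective (Fin.ext hef)))
    (fun e => by rw [hcard]; exact Fin.is_lt _) ?_
  intro e f hne w he hf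
  obtain ⟨u, rfl⟩ := h.edgeEquiv.surjective e
  obtain ⟨v, rfl⟩ := h.edgeEquiv.surjective f
  rw [hcard]
  simp only [Equiv.symm_apply_apply]
  rcases h.eq_of_mem_edgeEquiv (fun huv => hne (congrArg _ huv)) he hf with rfl | rfl
  · rw [← hgσ]; exact hτ _
  · rw [← hgσ]; exact (hτ _).symm

end SimpleGraph

/-! ### Arrays partitioned into cyclic lists -/

theorem List.IsCyclicChain.map_of_mem {α β : Type*} {R : α → α → Prop} {S : β → β → Prop}
    {l : List α} {f : α → β} (h : l.IsCyclicChain R)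
    (hf : ∀ a ∈ l, ∀ b ∈ l, R a b → S (f a) (f b)) : (l.map f).IsCyclicChain S := by
  constructor
  · rw [List.isChain_iff_getElem]
    intro i hi
    simp only [List.getElem_map]
    exact hf _ (List.getElem_mem _) _ (List.getElem_mem _)
      (List.isChain_iff_getElem.1 h.1 i (by simpa using hi))
  · intro b hb c hc
    rw [List.getLast?_map, Option.mem_def, Option.map_eq_some_iff] at hb
    rw [List.head?_map, Option.mem_def, Option.map_eq_some_iff] at hc
    obtain ⟨b, hb, rfl⟩ := hb
    obtain ⟨c, hc, rfl⟩ := hc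
    exact hf _ (List.mem_of_getLast? hb) _ (List.mem_of_head? hc) (h.2 _ hb _ hc)

/-- Move a cell of an array by `t` columns. -/
def shiftCell {K : ℕ} (t : ℕ) (p : Fin K × ℕ) : Fin K × ℕ := (p.1, p.2 + t)

theorem shiftCell_injective {K : ℕ} (t : ℕ) :
    Function.Injective (shiftCell t : Fin K × ℕ → Fin K × ℕ) := by
  rintro ⟨a, i⟩ ⟨b, j⟩ h
  simp only [shiftCell, Prod.mk.injEq, Nat.add_right_cancel_iff] at h
  rw [h.1, h.2]

/-- The lists in `L` are cyclic chains for `R` that partition an array with `K` rows, whose row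
`r` consists of the cells `(r, 0), …, (r, s + δ r - 1)`. -/
structure IsArrangement {K : ℕ} (δ : Fin K → ℕ) (R : Fin K × ℕ → Fin K × ℕ → Prop) (s : ℕ)
    (L : List (List (Fin K × ℕ))) : Prop where
  nodup : L.flatten.Nodup
  lt : ∀ p ∈ L.flatten, p.2 < s + δ p.1
  length : L.flatten.length = K * s + ∑ r, δ r
  chain : ∀ l ∈ L, l.IsCyclicChain R

instance {K : ℕ} (δ : Fin K → ℕ) (R : Fin K × ℕ → Fin K × ℕ → Prop) [DecidableRel R] (s : ℕ)
    (L : List (List (Fin K × ℕ))) : Decidable (IsArrangement δ R s L) :=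
  decidable_of_iff (L.flatten.Nodup ∧ (∀ p ∈ L.flatten, p.2 < s + δ p.1) ∧
    L.flatten.length = K * s + ∑ r, δ r ∧
      ∀ l ∈ L, l.IsChain R ∧ ∀ a ∈ l.getLast?, ∀ b ∈ l.head?, R a b)
    ⟨fun h => ⟨h.1, h.2.1, h.2.2.1, h.2.2.2⟩, fun h => ⟨h.1, h.2, h.3, h.4⟩⟩

namespace IsArrangement

variable {K : ℕ} {δ : Fin K → ℕ} {R : Fin K × ℕ → Fin K × ℕ → Prop} {s : ℕ}
  {L : List (List (Fin K × ℕ))}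

theorem perm (h : IsArrangement δ R s L) {L' : List (List (Fin K × ℕ))} (hL : L.Perm L') :
    IsArrangement δ R s L' where
  nodup := hL.flatten.nodup_iff.1 h.nodup
  lt p hp := h.lt p (hL.flatten.mem_iff.2 hp)
  length := hL.flatten.length_eq ▸ h.length
  chain l hl := h.chain l (hL.mem_iff.2 hl)

/-- Rectangular arrangements can be put in front of other arrangements. -/
theorem append {R' : Fin K × ℕ → Fin K × ℕ → Prop} {t : ℕ} {D : List (List (Fin K × ℕ))}
    (hD : IsArrangement (fun _ => 0) R' t D) (h : IsArrangement δ R s L)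
    (hR : ∀ p q, R' p q → R p q)
    (hshift : ∀ p q, R p q → R (shiftCell t p) (shiftCell t q)) :
    IsArrangement δ R (t + s) (D ++ L.map (List.map (shiftCell t))) where
  nodup := by
    rw [List.flatten_append, ← List.map_flatten, List.nodup_append']
    refine ⟨hD.nodup, h.nodup.map (shiftCell_injective t), ?_⟩
    intro p hp hp'
    obtain ⟨q, -, rfl⟩ := List.mem_map.1 hp'
    have := hD.lt _ hp
    simp [shiftCell] at this
  lt p hp := by
    rw [List.flatten_append, ← List.map_flatten, List.mem_append] at hp
    rcases hp with hp | hp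
    · have := hD.lt p hp
      simp only [add_zero] at this
      omega
    · obtain ⟨q, hq, rfl⟩ := List.mem_map.1 hp
      have := h.lt q hq
      simp only [shiftCell]
      omega
  length := by
    rw [List.flatten_append, ← List.map_flatten, List.length_append, List.length_map, hD.length,
      h.length]
    simp only [Finset.sum_const_zero]
    ring
  chain l hl := by
    rcases List.mem_append.1 hl with hl | hl
    · simpa using (hD.chain l hl).map_of_mem (f := id) (S := R) (fun a _ b _ => hR a b)
    · obtain ⟨l', hl', rfl⟩ := List.mem_map.1 hl
      exact (h.chain l' hl').map_of_mem fun a _ b _ => hshift a b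

/-- Numbering the cells of an arrangement gives a permutation. -/
theorem exists_perm {n : ℕ} (h : IsArrangement δ R s L) (hlen : ∀ l ∈ L, 3 ≤ l.length)
    (hn : n = K * s + ∑ r, δ r) (hn0 : n ≠ 0) (pos : Fin K × ℕ → ℕ) {S : ℕ → ℕ → Prop}
    (hlt : ∀ p, p.2 < s + δ p.1 → pos p < n)
    (hinj : ∀ p q, p.2 < s + δ p.1 → q.2 < s + δ q.1 → pos p = pos q → p = q)
    (hS : ∀ p q, p.2 < s + δ p.1 → q.2 < s + δ q.1 → R p q → S (pos p) (pos q)) :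
    ∃ τ : Equiv.Perm (Fin n), (∀ a : Fin n, S (a : ℕ) (τ a : ℕ)) ∧
      τ.cycleType = (L.map List.length : Multiset ℕ) := by
  have : NeZero n := ⟨hn0⟩
  let f : Fin K × ℕ → Fin n := fun p => Fin.ofNat n (pos p)
  have hf : ∀ p, p.2 < s + δ p.1 → (f p : ℕ) = pos p := fun p hp => by
    simp only [f, Fin.val_ofNat]
    exact Nat.mod_eq_of_lt (hlt p hp)
  have hnd : (L.map (List.map f)).flatten.Nodup := by
    rw [← List.map_flatten]
    refine List.Nodup.map_on ?_ h.nodup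
    intro p hp q hq hpq
    refine hinj p q (h.lt p hp) (h.lt q hq) ?_
    rw [← hf p (h.lt p hp), ← hf q (h.lt q hq), hpq]
  have hcov : ∀ a, a ∈ (L.map (List.map f)).flatten := by
    intro a
    -- The list has `n` distinct entries in `Fin n`, so it omits nothing.
    rw [← List.mem_toFinset, Finset.eq_univ_of_card (L.map (List.map f)).flatten.toFinset]
    · exact Finset.mem_univ a
    · rw [List.toFinset_card_of_nodup hnd, ← List.map_flatten, List.length_map, h.length,
        Fintype.card_fin, hn]
  obtain ⟨τ, hτ, -, hct⟩ := Equiv.Perm.exists_of_cyclicChains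
    (R := fun a b : Fin n => S (a : ℕ) (b : ℕ)) hnd hcov (by
      intro l' hl'
      obtain ⟨l, hl, rfl⟩ := List.mem_map.1 hl'
      simpa using hlen l hl) (by
      intro l' hl'
      obtain ⟨l, hl, rfl⟩ := List.mem_map.1 hl'
      have hmem : ∀ p ∈ l, p.2 < s + δ p.1 := fun p hp =>
        h.lt p (List.mem_flatten.2 ⟨l, hl, hp⟩)
      refine (h.chain l hl).map_of_mem fun p hp q hq hpq => ?_
      rw [hf p (hmem p hp), hf q (hmem q hq)]
      exact hS p q (hmem p hp) (hmem q hq) hpq)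
  refine ⟨τ, hτ, ?_⟩
  rw [hct, List.map_map]
  congr 1
  exact List.map_congr_left fun l _ => by simp

end IsArrangement

/-! ### Three-row arrays and the bound `n / 3` -/

/-- Cells of a three-row array whose positions are at cyclic distance at least `s` when row `r` has
length `s + δ r` and the rows are concatenated. -/
def RowsFar (δ : Fin 3 → ℕ) (p q : Fin 3 × ℕ) : Prop :=
  (q.1 = p.1 + 1 ∧ p.2 ≤ q.2 + δ p.1) ∨ (p.1 = q.1 + 1 ∧ q.2 ≤ p.2 + δ q.1)

instance (δ : Fin 3 → ℕ) : DecidableRel (RowsFar δ) := fun _ _ =>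
  inferInstanceAs (Decidable (_ ∨ _))

/-- The last cell of the list lies in the row after that of the first cell. -/
def EndsInNextRow (l : List (Fin 3 × ℕ)) : Prop :=
  ∀ u ∈ l.head?, ∀ v ∈ l.getLast?, v.1 = u.1 + 1

instance : DecidablePred EndsInNextRow := fun l =>
  inferInstanceAs (Decidable (∀ u ∈ l.head?, ∀ v ∈ l.getLast?, v.1 = u.1 + 1))

/-- Some three-row array is partitioned into cycles with lengths `m`. -/
def ThreeRowRealizable (δ : Fin 3 → ℕ) (m : Multiset ℕ) : Prop :=
  ∃ (s : ℕ) (L : List (List (Fin 3 × ℕ))), IsArrangement δ (RowsFar δ) s L ∧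
    (∀ l ∈ L, EndsInNextRow l) ∧ (L.map List.length : Multiset ℕ) = m

theorem RowsFar.shiftCell {δ : Fin 3 → ℕ} {p q : Fin 3 × ℕ} (t : ℕ) (h : RowsFar δ p q) :
    RowsFar δ (shiftCell t p) (shiftCell t q) := by
  rcases h with ⟨h1, h2⟩ | ⟨h1, h2⟩
  · exact Or.inl ⟨h1, by simp only [_root_.shiftCell]; omega⟩
  · exact Or.inr ⟨h1, by simp only [_root_.shiftCell]; omega⟩

theorem RowsFar.of_zero {δ : Fin 3 → ℕ} {p q : Fin 3 × ℕ} (h : RowsFar (fun _ => 0) p q) :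
    RowsFar δ p q := by
  rcases h with ⟨h1, h2⟩ | ⟨h1, h2⟩
  · exact Or.inl ⟨h1, h2.trans (Nat.le_add_right _ _)⟩
  · exact Or.inr ⟨h1, h2.trans (Nat.le_add_right _ _)⟩

theorem EndsInNextRow.map_shiftCell {l : List (Fin 3 × ℕ)} (h : EndsInNextRow l) (t : ℕ) :
    EndsInNextRow (l.map (shiftCell t)) := by
  intro u hu v hv
  rw [List.head?_map, Option.mem_def, Option.map_eq_some_iff] at hu
  rw [List.getLast?_map, Option.mem_def, Option.map_eq_some_iff] at hv
  obtain ⟨u, hu, rfl⟩ := hu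
  obtain ⟨v, hv, rfl⟩ := hv
  exact h u hu v hv

namespace ThreeRowRealizable

variable {δ : Fin 3 → ℕ} {m : Multiset ℕ}

/-- The rectangle goes on the left, so the uneven row ends stay on the right; `RowsFar` depends only
on rows and column differences, so it survives the shift. -/
theorem add (h : ThreeRowRealizable δ m) {k : Multiset ℕ}
    (hk : ThreeRowRealizable (fun _ => 0) k) : ThreeRowRealizable δ (k + m) := by
  obtain ⟨s, L, hL, hL', rfl⟩ := h
  obtain ⟨t, D, hD, hD', rfl⟩ := hk
  refine ⟨t + s, _, hD.append hL (fun _ _ => RowsFar.of_zero) (fun _ _ => RowsFar.shiftCell t),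
    ?_, ?_⟩
  · intro l hl
    rcases List.mem_append.1 hl with hl | hl
    · exact hD' l hl
    · obtain ⟨l', hl', rfl⟩ := List.mem_map.1 hl
      exact (hL' l' hl').map_shiftCell t
  · rw [List.map_append, List.map_map, ← Multiset.coe_add]
    congr 2
    exact List.map_congr_left fun l _ => by simp

/-- A cycle is lengthened by a new first column. -/
theorem lengthen {k : ℕ} (h : ThreeRowRealizable δ (k ::ₘ m)) (hk : k ≠ 0) :
    ThreeRowRealizable δ ((k + 3) ::ₘ m) := by
  obtain ⟨s, L, hL, hL', hm⟩ := h
  have hkL : k ∈ L.map List.length := by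
    rw [← Multiset.mem_coe, hm]; exact Multiset.mem_cons_self k m
  obtain ⟨l, hl, rfl⟩ := List.mem_map.1 hkL
  have hperm := List.perm_cons_erase hl
  replace hL := hL.perm hperm
  replace hL' : ∀ l' ∈ l :: L.erase l, EndsInNextRow l' := fun l' h' => hL' l' (hperm.mem_iff.2 h')
  have hm' : ((L.erase l).map List.length : Multiset ℕ) = m := by
    rw [Multiset.coe_eq_coe.2 (hperm.map _), List.map_cons, ← Multiset.cons_coe,
      Multiset.cons_inj_right] at hm
    exact hm
  generalize L.erase l = L at *
  obtain ⟨u, l, rfl⟩ := List.exists_cons_of_length_pos (Nat.pos_of_ne_zero hk)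
  obtain ⟨v, hv⟩ : ∃ v, (u :: l).getLast? = some v := ⟨_, List.getLast?_cons⟩
  have huv : v.1 = u.1 + 1 := hL' _ (List.mem_cons_self ..) u rfl v hv
  -- The three new cells run through the rows starting from that of `u`, so stepping on to `u` is
  -- again a step to the next row. The old last cell lies in the row after that of `u`, so it can
  -- close up at the new first cell, which preserves `EndsInNextRow`.
  have hcol : IsArrangement (fun _ => 0) (RowsFar fun _ => 0) 1
      [[((u.1, 0) : Fin 3 × ℕ), (u.1 + 1, 0), (u.1 + 2, 0)]] := by
    generalize u.1 = r
    revert r; decide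
  have happ := hcol.append hL (fun _ _ => RowsFar.of_zero) (fun _ _ => RowsFar.shiftCell 1)
  have hflat : ((((u.1, 0) : Fin 3 × ℕ) :: (u.1 + 1, 0) :: (u.1 + 2, 0) ::
      (u :: l).map (shiftCell 1)) :: L.map (List.map (shiftCell 1))).flatten =
      ([[((u.1, 0) : Fin 3 × ℕ), (u.1 + 1, 0), (u.1 + 2, 0)]] ++
        ((u :: l) :: L).map (List.map (shiftCell 1))).flatten := by
    simp
  have hlast : (((u.1, 0) : Fin 3 × ℕ) :: (u.1 + 1, 0) :: (u.1 + 2, 0) ::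
      (u :: l).map (shiftCell 1)).getLast? = some (shiftCell 1 v) := by
    have : ((u :: l).map (shiftCell 1)).getLast? = some (shiftCell 1 v) := by
      rw [List.getLast?_map, hv, Option.map_some]
    simpa only [List.map_cons, List.getLast?_cons_cons] using this
  refine ⟨1 + s, (((u.1, 0) : Fin 3 × ℕ) :: (u.1 + 1, 0) :: (u.1 + 2, 0) ::
    (u :: l).map (shiftCell 1)) :: L.map (List.map (shiftCell 1)), ⟨hflat ▸ happ.nodup,
      hflat ▸ happ.lt, hflat ▸ happ.length, ?_⟩, ?_, ?_⟩
  · intro l' hl'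
    rcases List.mem_cons.1 hl' with rfl | hl'
    · constructor
      · have h1 := (happ.chain ((u :: l).map (shiftCell 1)) (by simp)).1
        simp only [List.map_cons, List.isChain_cons_cons] at h1 ⊢
        refine ⟨Or.inl ⟨rfl, by simp⟩, Or.inl ⟨by generalize u.1 = r; revert r; decide, by simp⟩,
          Or.inl ⟨?_, by simp⟩, h1⟩
        simp only [shiftCell]
        generalize u.1 = r
        revert r; decide
      · intro a ha b hb
        rw [hlast] at ha
        simp only [List.head?_cons, Option.mem_def, Option.some.injEq] at ha hb
        subst ha hb
        exact Or.inr ⟨huv, by simp⟩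
    · exact happ.chain l' (by
        rw [List.map_cons]
        exact List.mem_append_right _ (List.mem_cons_of_mem _ hl'))
  · intro l' hl'
    rcases List.mem_cons.1 hl' with rfl | hl'
    · intro a ha b hb
      rw [hlast] at hb
      simp only [List.head?_cons, Option.mem_def, Option.some.injEq] at ha hb
      subst ha hb
      exact huv
    · obtain ⟨l₀, h₀, rfl⟩ := List.mem_map.1 hl'
      exact (hL' l₀ (List.mem_cons_of_mem _ h₀)).map_shiftCell 1
  · rw [← hm', List.map_cons, List.map_map, ← Multiset.cons_coe]
    congr 2
    · simp
    · exact List.map_congr_left fun l _ => by simp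

theorem zero : ThreeRowRealizable (fun _ => 0) 0 :=
  ⟨0, [], by decide, by decide, rfl⟩

theorem three : ThreeRowRealizable (fun _ => 0) {3} :=
  ⟨1, [[(2, 0), (1, 0), (0, 0)]], by decide, by decide, rfl⟩

/-- A rectangle needs a total divisible by 3. The minimal such collections of 4s and 5s are this one
and the next two. -/
theorem four_five : ThreeRowRealizable (fun _ => 0) {4, 5} :=
  ⟨3, [[(0, 0), (1, 0), (2, 1), (1, 1)], [(2, 0), (0, 2), (2, 2), (1, 2), (0, 1)]],
    by decide, by decide, rfl⟩

theorem four_four_four : ThreeRowRealizable (fun _ => 0) {4, 4, 4} :=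
  ⟨4, [[(0, 0), (1, 0), (2, 1), (1, 1)], [(0, 1), (1, 2), (2, 3), (1, 3)],
    [(2, 2), (0, 3), (2, 0), (0, 2)]], by decide, by decide, rfl⟩

theorem five_five_five : ThreeRowRealizable (fun _ => 0) {5, 5, 5} :=
  ⟨5, [[(0, 0), (1, 0), (2, 0), (0, 1), (1, 1)], [(2, 1), (0, 3), (2, 2), (1, 2), (0, 2)],
    [(2, 3), (1, 3), (2, 4), (1, 4), (0, 4)]], by decide, by decide, rfl⟩

/-- This and the next three are the nonempty collections of 4s and 5s containing no rectangular
block; the residue of the total modulo 3 gives the number of extra cells. -/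
theorem four : ThreeRowRealizable ![1, 0, 0] {4} :=
  ⟨1, [[(2, 0), (0, 1), (1, 0), (0, 0)]], by decide, by decide, rfl⟩

theorem five : ThreeRowRealizable ![1, 1, 0] {5} :=
  ⟨1, [[(2, 0), (1, 1), (0, 1), (1, 0), (0, 0)]], by decide, by decide, rfl⟩

theorem four_four : ThreeRowRealizable ![1, 1, 0] {4, 4} :=
  ⟨2, [[(0, 0), (1, 0), (0, 1), (1, 2)], [(2, 1), (1, 1), (2, 0), (0, 2)]],
    by decide, by decide, rfl⟩

theorem five_five : ThreeRowRealizable ![1, 0, 0] {5, 5} :=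
  ⟨3, [[(0, 0), (1, 0), (0, 1), (2, 1), (1, 1)], [(2, 0), (0, 3), (2, 2), (1, 2), (0, 2)]],
    by decide, by decide, rfl⟩

end ThreeRowRealizable

/-- All cycle lengths are realizable in an array with `s`, `s` or `s + 1`, and `s` or `s + 1` cells
in its rows. -/
theorem exists_threeRowRealizable (m : Multiset ℕ) (hm : ∀ k ∈ m, 3 ≤ k) :
    ∃ δ : Fin 3 → ℕ, ∑ r, δ r ≤ 2 ∧ ThreeRowRealizable δ m := by
  induction hN : m.sum using Nat.strong_induction_on generalizing m with
  | _ N ih =>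
    subst hN
    have step : ∀ k m', ThreeRowRealizable (fun _ => 0) k → m = k + m' → k.sum ≠ 0 →
        ∃ δ : Fin 3 → ℕ, ∑ r, δ r ≤ 2 ∧ ThreeRowRealizable δ m := by
      rintro k m' hk rfl hk0
      obtain ⟨δ, hδ, h⟩ := ih m'.sum (by rw [Multiset.sum_add]; omega) m'
        (fun x hx => hm x (Multiset.mem_add.2 (Or.inr hx))) rfl
      exact ⟨δ, hδ, h.add hk⟩
    have step' : ∀ k, ThreeRowRealizable (fun _ => 0) k → k ≤ m → k.sum ≠ 0 →
        ∃ δ : Fin 3 → ℕ, ∑ r, δ r ≤ 2 ∧ ThreeRowRealizable δ m := by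
      intro k hk hkm hk0
      obtain ⟨m', rfl⟩ := Multiset.le_iff_exists_add.1 hkm
      exact step k m' hk rfl hk0
    by_cases h6 : ∃ k ∈ m, 6 ≤ k
    · obtain ⟨k, hk, hk6⟩ := h6
      obtain ⟨m', rfl⟩ := Multiset.exists_cons_of_mem hk
      obtain ⟨δ, hδ, h⟩ := ih ((k - 3) ::ₘ m').sum (by simp only [Multiset.sum_cons]; omega)
        ((k - 3) ::ₘ m') (by
          intro x hx
          rcases Multiset.mem_cons.1 hx with rfl | hx
          · omega
          · exact hm x (Multiset.mem_cons_of_mem hx)) rfl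
      -- The bound `6 ≤ k` keeps the shortened cycle at length at least 3.
      have := h.lengthen (by omega)
      rw [Nat.sub_add_cancel (by omega)] at this
      exact ⟨δ, hδ, this⟩
    push Not at h6
    by_cases h3 : 3 ∈ m
    · exact step' {3} ThreeRowRealizable.three (Multiset.singleton_le.2 h3) (by simp)
    have h45 : ∀ k ∈ m, k = 4 ∨ k = 5 := by
      intro k hk
      have := hm k hk
      have := h6 k hk
      have : k ≠ 3 := fun h => h3 (h ▸ hk)
      omega
    by_cases h4 : 4 ∈ m
    · by_cases h5 : 5 ∈ m
      · refine step' {4, 5} ThreeRowRealizable.four_five ?_ (by simp)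
        exact (Multiset.le_iff_subset (by decide)).2 (by
          intro x hx
          simp only [Multiset.insert_eq_cons, Multiset.mem_cons, Multiset.mem_singleton] at hx
          rcases hx with rfl | rfl <;> assumption)
      · have hrep : m = Multiset.replicate (Multiset.card m) 4 :=
          Multiset.eq_replicate_card.2 fun k hk =>
            (h45 k hk).resolve_right fun h => h5 (h ▸ hk)
        rcases Nat.lt_or_ge (Multiset.card m) 3 with hc | hc
        · interval_cases Multiset.card m
          · exact ⟨fun _ => 0, by decide, by rw [hrep]; exact ThreeRowRealizable.zero⟩
          · exact ⟨![1, 0, 0], by decide, by rw [hrep]; exact ThreeRowRealizable.four⟩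
          · exact ⟨![1, 1, 0], by decide, by rw [hrep]; exact ThreeRowRealizable.four_four⟩
        · refine step' {4, 4, 4} ThreeRowRealizable.four_four_four ?_ (by simp)
          rw [hrep]
          exact Multiset.replicate_le_replicate 4 |>.2 hc
    · have hrep : m = Multiset.replicate (Multiset.card m) 5 :=
        Multiset.eq_replicate_card.2 fun k hk =>
          (h45 k hk).resolve_left fun h => h4 (h ▸ hk)
      rcases Nat.lt_or_ge (Multiset.card m) 3 with hc | hc
      · interval_cases Multiset.card m
        · exact ⟨fun _ => 0, by decide, by rw [hrep]; exact ThreeRowRealizable.zero⟩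
        · exact ⟨![1, 1, 0], by decide, by rw [hrep]; exact ThreeRowRealizable.five⟩
        · exact ⟨![1, 0, 0], by decide, by rw [hrep]; exact ThreeRowRealizable.five_five⟩
      · refine step' {5, 5, 5} ThreeRowRealizable.five_five_five ?_ (by simp)
        rw [hrep]
        exact Multiset.replicate_le_replicate 5 |>.2 hc

/-- For all cycle lengths at least three there is a permutation of `0, …, n - 1` that moves every
number by a cyclic distance of at least `n / 3`. -/
theorem exists_perm_cyclicallyFar_third {n : ℕ} (hn : n ≠ 0) (m : Multiset ℕ)
    (hm : ∀ k ∈ m, 3 ≤ k) (hsum : m.sum = n) :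
    ∃ τ : Equiv.Perm (Fin n), (∀ a : Fin n, SimpleGraph.CyclicallyFar n (n / 3) a (τ a)) ∧
      τ.cycleType = m := by
  obtain ⟨δ, hδ, s, L, hL, -, rfl⟩ := exists_threeRowRealizable m hm
  have hn' : n = 3 * s + ∑ r, δ r := by
    rw [← hL.length, List.length_flatten, ← hsum, Multiset.sum_coe]
  -- This is where at most two extra cells matter.
  have hs : n / 3 = s := by omega
  rw [hs]
  simp only [Fin.sum_univ_three] at hn'
  refine hL.exists_perm (by simpa using hm) (by simpa [Fin.sum_univ_three] using hn') hn
    (fun p => ![0, s + δ 0, 2 * s + δ 0 + δ 1] p.1 + p.2) (S := SimpleGraph.CyclicallyFar n s)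
    ?_ ?_ ?_
  · rintro ⟨r, i⟩ h
    fin_cases r <;> simp at h ⊢ <;> omega
  · rintro ⟨r, i⟩ ⟨t, j⟩ h1 h2
    fin_cases r <;> fin_cases t <;> simp at h1 h2 ⊢ <;> omega
  -- From column `i` of row `r` to column `j` of the next row, the forward distance is `s + δ r - i
  -- + j`, which is at least `s` exactly when `i ≤ j + δ r`. The row lengths make the backward
  -- distance large enough.
  · rintro ⟨r, i⟩ ⟨t, j⟩ h1 h2 h3
    unfold SimpleGraph.CyclicallyFar
    unfold RowsFar at h3
    fin_cases r <;> fin_cases t <;> simp at h1 h2 h3 ⊢ <;> omega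

/-! ### Two-row arrays and the bound `(n - 2) / 2` -/

/-- Cells in different rows and in equal or neighbouring columns of a two-row array. -/
def ColumnsClose (p q : Fin 2 × ℕ) : Prop :=
  p.1 ≠ q.1 ∧ p.2 ≤ q.2 + 1 ∧ q.2 ≤ p.2 + 1

instance : DecidableRel ColumnsClose := fun _ _ => inferInstanceAs (Decidable (_ ∧ _))

theorem exists_isArrangement_columnsClose_singleton (k : ℕ) :
    ∃ l : List (Fin 2 × ℕ), l.head? = some (0, 0) ∧ l.getLast? = some (1, 0) ∧
      IsArrangement (fun _ => 0) ColumnsClose (k + 1) [l] := by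
  induction k with
  | zero => exact ⟨[(0, 0), (1, 0)], rfl, rfl, by decide⟩
  | succ k ih =>
    obtain ⟨l, hhead, hlast, h⟩ := ih
    -- The old cycle moves one column right with its rows swapped: it now runs from `(1, 1)` to `(0,
    -- 1)`, so the new cells `(0, 0)` and `(1, 0)` can be attached at its ends.
    let f : Fin 2 × ℕ → Fin 2 × ℕ := fun p => (p.1 + 1, p.2 + 1)
    have hf : Function.Injective f := by
      rintro ⟨a, i⟩ ⟨b, j⟩ hab
      simpa [f] using hab
    have hnd : l.Nodup := by simpa using h.nodup
    have hlen : l.length = 2 * (k + 1) := by simpa using h.length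
    refine ⟨(0, 0) :: (l.map f ++ [(1, 0)]), rfl,
      by rw [← List.cons_append, List.getLast?_concat], ?_, ?_, ?_, ?_⟩
    · simp only [List.flatten_singleton, List.nodup_cons, List.nodup_append']
      refine ⟨?_, hnd.map hf, by simp, ?_⟩
      · simp [f]
      · simp [f, List.Disjoint]
    · intro p hp
      simp only [List.flatten_singleton, List.mem_cons, List.mem_append, List.mem_map,
        List.not_mem_nil, or_false] at hp
      rcases hp with rfl | ⟨q, hq, rfl⟩ | rfl
      · simp
      · have := h.lt q (by simpa using hq)
        simp only [f]
        omega
      · simp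
    · simp [hlen]
      ring
    · intro l' hl'
      obtain rfl := List.mem_singleton.1 hl'
      have hc : (l.map f).IsCyclicChain ColumnsClose :=
        (h.chain l (by simp)).map_of_mem fun p _ q _ hpq => by
          obtain ⟨h1, h2, h3⟩ := hpq
          exact ⟨by simpa [f] using h1, by simp only [f]; omega, by simp only [f]; omega⟩
      refine ⟨?_, ?_⟩
      · rw [List.isChain_cons, List.isChain_append]
        refine ⟨?_, hc.1, by simp, ?_⟩
        · intro y hy
          rw [List.head?_append, List.head?_map, hhead] at hy
          simp only [Option.map_some, Option.some_or, Option.mem_def, Option.some.injEq] at hy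
          subst hy
          exact ⟨by simp [f], by simp [f]⟩
        · intro x hx y hy
          rw [List.getLast?_map, hlast] at hx
          simp only [Option.map_some, Option.mem_def, Option.some.injEq, List.head?_cons] at hx hy
          subst hx hy
          exact ⟨by simp [f], by simp [f]⟩
      · intro a ha b hb
        have ha' := List.getLast?_concat (l := ((0, 0) : Fin 2 × ℕ) :: l.map f) (a := (1, 0))
        rw [List.cons_append] at ha'
        rw [ha'] at ha
        simp only [List.head?_cons, Option.mem_def, Option.some.injEq] at ha hb
        subst ha hb
        exact ⟨by simp, by simp⟩

theorem exists_isArrangement_columnsClose (m : Multiset ℕ) (hm : ∀ k ∈ m, Even k)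
    (hm0 : ∀ k ∈ m, k ≠ 0) :
    ∃ s L, IsArrangement (fun _ => 0) ColumnsClose s L ∧
      (L.map List.length : Multiset ℕ) = m := by
  induction m using Multiset.induction_on with
  | empty => exact ⟨0, [], by decide, rfl⟩
  | cons k m ih =>
    obtain ⟨s, L, hL, rfl⟩ := ih (fun x hx => hm x (Multiset.mem_cons_of_mem hx))
      (fun x hx => hm0 x (Multiset.mem_cons_of_mem hx))
    obtain ⟨j, hj⟩ := hm k (Multiset.mem_cons_self _ _)
    have hj0 := hm0 k (Multiset.mem_cons_self _ _)
    obtain ⟨i, rfl⟩ : ∃ i, j = i + 1 := ⟨j - 1, by omega⟩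
    obtain ⟨l, -, -, hl⟩ := exists_isArrangement_columnsClose_singleton i
    have hlen : l.length = 2 * (i + 1) := by simpa using hl.length
    refine ⟨_, _, hl.append hL (fun _ _ h => h) ?_, ?_⟩
    · rintro p q ⟨h1, h2, h3⟩
      exact ⟨h1, by simp only [shiftCell]; omega, by simp only [shiftCell]; omega⟩
    · rw [List.singleton_append, List.map_cons, List.map_map, ← Multiset.cons_coe, hlen, hj]
      congr 2
      · ring
      · exact List.map_congr_left fun l _ => by simp

/-- For all even cycle lengths at least four there is a permutation of `0, …, n - 1` that moves
every number by a cyclic distance of at least `(n - 2) / 2`. -/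
theorem exists_perm_cyclicallyFar_half {n : ℕ} (hn : n ≠ 0) (m : Multiset ℕ)
    (hm : ∀ k ∈ m, Even k) (hm3 : ∀ k ∈ m, 3 ≤ k) (hsum : m.sum = n) :
    ∃ τ : Equiv.Perm (Fin n), (∀ a : Fin n, SimpleGraph.CyclicallyFar n ((n - 2) / 2) a (τ a)) ∧
      τ.cycleType = m := by
  obtain ⟨s, L, hL, rfl⟩ := exists_isArrangement_columnsClose m hm fun k hk => by
    have := hm3 k hk; omega
  have hn' : n = 2 * s := by
    rw [← hsum, Multiset.sum_coe, ← List.length_flatten, hL.length]; simp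
  have hs : (n - 2) / 2 = s - 1 := by omega
  rw [hs]
  refine hL.exists_perm (by simpa using hm3) (by simpa using hn') hn
    (fun p => ![0, s] p.1 + p.2) (S := SimpleGraph.CyclicallyFar n (s - 1)) ?_ ?_ ?_
  · rintro ⟨r, i⟩ h
    fin_cases r <;> simp at h ⊢ <;> omega
  · rintro ⟨r, i⟩ ⟨t, j⟩ h1 h2
    fin_cases r <;> fin_cases t <;> simp at h1 h2 ⊢ <;> omega
  -- Positions `i` and `s + j` have arcs `s + j - i` and `s + i - j` between them, both at least `s
  -- - 1` for close columns.
  · rintro ⟨r, i⟩ ⟨t, j⟩ h1 h2 h3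
    unfold SimpleGraph.CyclicallyFar
    unfold ColumnsClose at h3
    fin_cases r <;> fin_cases t <;> simp at h1 h2 h3 ⊢ <;> omega

/-! ### Class 1, extremal graphs and the two minima -/

namespace SimpleGraph

theorem isRegularOfDegree_two_iff {V : Type*} {G : SimpleGraph V} [G.LocallyFinite] :
    G.IsRegularOfDegree 2 ↔ ∀ v, (G.neighborSet v).ncard = 2 := by
  refine forall_congr' fun v => ?_
  rw [← card_neighborSet_eq_degree, ← Nat.card_eq_fintype_card, Nat.card_coe_set_eq]

/-- The cycle lengths of a traversed graph with properly two-coloured edges are even. -/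
theorem IsTraversal.even_of_mem_cycleType {V : Type*} [Fintype V] [DecidableEq V]
    {G : SimpleGraph V} {σ : Equiv.Perm V} (h : G.IsTraversal σ) (hG : G.lineGraph.Colorable 2)
    {k : ℕ} (hk : k ∈ σ.cycleType) : Even k := by
  obtain ⟨C⟩ := hG
  have hC : ∀ v, C (h.edgeEquiv (σ v)) ≠ C (h.edgeEquiv v) := by
    intro v
    refine (C.valid ?_).symm
    rw [lineGraph_adj_iff_exists]
    refine ⟨fun h' => (h.adj v).ne (h.edgeEquiv.injective h'), σ v, ?_, ?_⟩ <;>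
      simp [coe_edgeEquiv]
  -- With two colours, each step along `σ` switches the colour; going once round a cycle restores
  -- it.
  have hpow : ∀ v, ∀ j : ℕ, C (h.edgeEquiv ((σ ^ j) v)) = C (h.edgeEquiv v) ↔ Even j := by
    intro v j
    induction j with
    | zero => simp
    | succ j ih =>
      rw [Nat.even_add_one, ← ih, pow_succ', Equiv.Perm.mul_apply]
      have := hC ((σ ^ j) v)
      omega
  obtain ⟨v, hv⟩ := Equiv.Perm.exists_pow_apply_eq_of_mem_cycleType hk
  exact (hpow v k).1 (by rw [hv])

theorem exists_isTraversal {n : ℕ} {G : SimpleGraph (Fin n)}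
    (hG : ∀ v, (G.neighborSet v).ncard = 2) :
    ∃ σ, G.IsTraversal σ ∧ (∀ k ∈ σ.cycleType, 3 ≤ k) ∧ σ.cycleType.sum = n := by
  obtain ⟨L, hnd, hcov, hlen, hR⟩ := exists_cyclicChains_of_ncard_neighborSet hG
  obtain ⟨σ, hσ, hct⟩ := exists_isTraversal_of_cyclicChains hG hnd hcov hlen hR
  refine ⟨σ, hσ, by simpa [hct] using hlen, ?_⟩
  have : σ.support = Finset.univ := by
    ext v
    simpa using (hσ.adj v).ne'
  rw [Equiv.Perm.sum_cycleType, this, Finset.card_univ, Fintype.card_fin]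

theorem nonempty_edgeSet {n : ℕ} {G : SimpleGraph (Fin n)} (hn : n ≠ 0)
    (hG : ∀ v, (G.neighborSet v).ncard = 2) : G.edgeSet.Nonempty := by
  have : NeZero n := ⟨hn⟩
  obtain ⟨w, hw⟩ := Set.nonempty_of_ncard_ne_zero (s := G.neighborSet 0) (by rw [hG]; norm_num)
  exact ⟨s(0, w), hw⟩

theorem third_le_cms {n : ℕ} (hn : n ≠ 0) {G : SimpleGraph (Fin n)}
    (hG : ∀ v, (G.neighborSet v).ncard = 2) : n / 3 ≤ G.cms := by
  obtain ⟨σ, hσ, h3, hsum⟩ := exists_isTraversal hG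
  obtain ⟨τ, hτ, hct⟩ := exists_perm_cyclicallyFar_third hn _ h3 hsum
  exact (isGreatest_cms G (nonempty_edgeSet hn hG)).2
    (hσ.isCyclicallyMatchingSequenceable hn (Nat.div_le_self n 3) hct.symm hτ)

theorem half_le_cms {n : ℕ} (hn : n ≠ 0) {G : SimpleGraph (Fin n)}
    (hG : ∀ v, (G.neighborSet v).ncard = 2) (hG2 : G.lineGraph.Colorable 2) :
    (n - 2) / 2 ≤ G.cms := by
  obtain ⟨σ, hσ, h3, hsum⟩ := exists_isTraversal hG
  obtain ⟨τ, hτ, hct⟩ := exists_perm_cyclicallyFar_half hn _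
    (fun k hk => hσ.even_of_mem_cycleType hG2 hk) h3 hsum
  exact (isGreatest_cms G (nonempty_edgeSet hn hG)).2
    (hσ.isCyclicallyMatchingSequenceable hn (by omega) hct.symm hτ)

/-- The graph whose edges join each vertex to its image under `σ`. -/
def permGraph {V : Type*} (σ : Equiv.Perm V) : SimpleGraph V where
  Adj u v := u ≠ v ∧ (σ u = v ∨ σ v = u)
  symm := ⟨fun _ _ h => ⟨h.1.symm, h.2.symm⟩⟩
  loopless := ⟨fun _ h => h.1 rfl⟩

theorem permGraph_isTraversal {V : Type*} {σ : Equiv.Perm V} (hσ : ∀ v, σ (σ v) ≠ v) :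
    (permGraph σ).IsTraversal σ where
  adj_iff u v := by
    refine ⟨fun h => h.2, fun h => ⟨?_, h⟩⟩
    rintro rfl
    exact hσ u (by rcases h with h | h <;> rw [h, h])
  ne := hσ

theorem val_finRotate {n : ℕ} (i : Fin n) :
    (finRotate n i : ℕ) = if (i : ℕ) + 1 = n then 0 else (i : ℕ) + 1 := by
  cases n with
  | zero => exact i.elim0
  | succ n =>
    rw [coe_finRotate]
    simp [Fin.ext_iff]

theorem finRotate_finRotate_ne {n : ℕ} (hn : 3 ≤ n) (i : Fin n) :
    finRotate n (finRotate n i) ≠ i := by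
  intro h
  have := congrArg Fin.val h
  rw [val_finRotate, val_finRotate] at this
  split_ifs at this <;> omega

/-- For `n ≥ 6` there is a `2`-regular graph containing a triangle. -/
theorem exists_isTraversal_triangle {n : ℕ} (hn : 6 ≤ n) :
    ∃ (G : SimpleGraph (Fin n)) (σ : Equiv.Perm (Fin n)), G.IsTraversal σ ∧
      ∃ a b c, G.Adj a b ∧ G.Adj b c ∧ G.Adj c a := by
  -- Since `n ≥ 6`, the `m ≥ 3` vertices off the triangle can form a cycle.
  obtain ⟨m, rfl⟩ : ∃ m, n = 3 + m := ⟨n - 3, by omega⟩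
  let σ : Equiv.Perm (Fin (3 + m)) :=
    finSumFinEquiv.permCongr (Equiv.sumCongr (finRotate 3) (finRotate m))
  have hσ : ∀ v, σ (σ v) ≠ v := by
    intro v
    obtain ⟨x, rfl⟩ := finSumFinEquiv.surjective v
    rcases x with x | x
    · simpa [σ, Equiv.permCongr_apply] using finRotate_finRotate_ne le_rfl x
    · simpa [σ, Equiv.permCongr_apply] using finRotate_finRotate_ne (by omega) x
  have h := permGraph_isTraversal hσ
  refine ⟨permGraph σ, σ, h, finSumFinEquiv (Sum.inl 0), _, _, h.adj _, h.adj _, ?_⟩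
  convert h.adj (σ (σ (finSumFinEquiv (Sum.inl 0))))
  simp [σ, Equiv.permCongr_apply]

/-- Each edge is coloured by the parity of its index; evenness of `n` makes this consistent where
the rotation wraps to `0`. -/
theorem colorable_lineGraph_permGraph_finRotate {n : ℕ} (hn : 3 ≤ n) (hn2 : Even n) :
    (permGraph (finRotate n)).lineGraph.Colorable 2 := by
  have h := permGraph_isTraversal (finRotate_finRotate_ne hn)
  have key : ∀ v : Fin n, (finRotate n v : ℕ) % 2 ≠ (v : ℕ) % 2 := by
    intro v
    have := v.is_lt
    obtain ⟨k, hk⟩ := hn2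
    rw [val_finRotate]
    split_ifs <;> omega
  refine ⟨Coloring.mk (fun e => (Fin.ofNat 2 (h.edgeEquiv.symm e : ℕ))) ?_⟩
  intro e f hef
  obtain ⟨u, rfl⟩ := h.edgeEquiv.surjective e
  obtain ⟨v, rfl⟩ := h.edgeEquiv.surjective f
  obtain ⟨hne, w, hu, hv⟩ := lineGraph_adj_iff_exists.1 hef
  rw [Ne, Fin.ext_iff]
  simp only [Equiv.symm_apply_apply, Fin.val_ofNat]
  rcases h.eq_of_mem_edgeEquiv (fun huv => hne (congrArg _ huv)) hu hv with rfl | rfl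
  · exact (key u).symm
  · exact key v

theorem two_le_chromaticIndex {n : ℕ} (hn : n ≠ 0) {G : SimpleGraph (Fin n)}
    {σ : Equiv.Perm (Fin n)} (h : G.IsTraversal σ) : 2 ≤ G.chromaticIndex := by
  have : NeZero n := ⟨hn⟩
  refine two_le_chromaticNumber_of_adj (u := h.edgeEquiv 0) (v := h.edgeEquiv (σ 0)) ?_
  rw [lineGraph_adj_iff_exists]
  refine ⟨fun h' => (h.adj 0).ne (h.edgeEquiv.injective h'), σ 0, ?_, ?_⟩ <;>
    simp [IsTraversal.coe_edgeEquiv]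

theorem isClassOne_iff {n : ℕ} (hn : n ≠ 0) {G : SimpleGraph (Fin n)}
    (hG : ∀ v, (G.neighborSet v).ncard = 2) : G.IsClassOne ↔ G.lineGraph.Colorable 2 := by
  classical
  have : NeZero n := ⟨hn⟩
  obtain ⟨σ, hσ, -⟩ := exists_isTraversal hG
  rw [IsClassOne, (isRegularOfDegree_two_iff.2 hG).maxDegree_eq, ← chromaticNumber_le_iff_colorable]
  exact ⟨fun h => h.le, fun h => le_antisymm h (two_le_chromaticIndex hn hσ)⟩

theorem isLeast_cmsValues {n : ℕ} (hn : 6 ≤ n) : IsLeast (cmsValues n 2) (n / 3) := by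
  classical
  have hn0 : n ≠ 0 := by omega
  constructor
  · obtain ⟨G, σ, hσ, a, b, c, hab, hbc, hca⟩ := exists_isTraversal_triangle hn
    have hG := hσ.ncard_neighborSet
    refine ⟨G, isRegularOfDegree_two_iff.2 hG, le_antisymm ?_ (third_le_cms hn0 hG)⟩
    have := (isGreatest_cms G (nonempty_edgeSet hn0 hG)).1.le_of_triangle hab hbc hca
    rwa [hσ.card_edgeSet, Nat.card_fin] at this
  · rintro _ ⟨G, hG, rfl⟩
    exact third_le_cms hn0 (isRegularOfDegree_two_iff.1 hG)

theorem isLeast_cmsValuesClassOne {n : ℕ} (hn : 4 ≤ n) (hn2 : Even n) :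
    IsLeast (cmsValuesClassOne n 2) ((n - 2) / 2) := by
  classical
  have hn0 : n ≠ 0 := by omega
  constructor
  · have hσ := permGraph_isTraversal (finRotate_finRotate_ne (n := n) (by omega))
    have hG := hσ.ncard_neighborSet
    have hcol := colorable_lineGraph_permGraph_finRotate (by omega) hn2
    refine ⟨permGraph (finRotate n), isRegularOfDegree_two_iff.2 hG,
      (isClassOne_iff hn0 hG).2 hcol, le_antisymm ?_ (half_le_cms hn0 hG hcol)⟩
    have : NeZero n := ⟨hn0⟩
    -- Three successive edges from `0` give `2 * cms < n`; as `n` is even, this yields `(n - 2) /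
    -- 2`.
    have := (isGreatest_cms _ (nonempty_edgeSet hn0 hG)).1.lt_of_path (hσ.adj 0) (hσ.adj _)
      (hσ.adj _) (hσ.ne _).symm (hσ.ne _).symm
    rw [hσ.card_edgeSet, Nat.card_fin] at this
    obtain ⟨k, hk⟩ := hn2
    omega
  · rintro _ ⟨G, hG, hG1, rfl⟩
    have hG' := isRegularOfDegree_two_iff.1 hG
    exact half_le_cms hn0 hG' ((isClassOne_iff hn0 hG').1 hG1)

end SimpleGraph

theorem theorem2 :
    (∀ n : ℕ, 6 ≤ n → IsLeast (SimpleGraph.cmsValues n 2) (n / 3)) ∧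
    (∀ n : ℕ, 4 ≤ n → Even n → IsLeast (SimpleGraph.cmsValuesClassOne n 2) ((n - 2) / 2)) :=
  ⟨fun _ hn => SimpleGraph.isLeast_cmsValues hn,
    fun _ hn hn2 => SimpleGraph.isLeast_cmsValuesClassOne hn hn2⟩
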